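/- Let $\mathscr{H}$ be a complex separable Hilbert space and let $\mathscr{X}$ be a measurable space (for instance a locally compact Hausdorff space with its Borel $\sigma$-algebra). Let $\ell$ be an operator-valued measure on $\mathscr{X}$: it assigns to each measurable set $E\subseteq\mathscr{X}$ a bounded self-adjoint operator $\ell(E)$ on $\mathscr{H}$, and $\ell\big(\bigcup_n E_n\big)\psi=\sum_n \ell(E_n)\psi$ in norm for all $\psi\in\mathscr{H}$ and every sequence $(E_n)_{n\in\mathbb{N}}$ of pairwise disjoint measurable sets. Suppose that $\ell(E)$ is a positive (semi-definite) trace-class operator for every measurable $E$. For a simple measurable function $g=\sum_{i=1}^n \alpha_i\mathbf{1}_{E_i}$ with disjoint measurable sets $E_i$ and $\alpha_i\in\mathbb{R}$, put $\int g\,d\ell=\sum_{i=1}^n\alpha_i\,\ell(E_i)$. For a bounded measurable $f\colon\mathscr{X}\to\mathbb{R}$, put $\int f\,d\ell=\lim_{n\to\infty}\int f_n\,d\ell$, a limit in operator norm, where $(f_n)$ is any sequence of real-valued simple measurable functions converging uniformly to $f$. Then $E\mapsto\operatorname{Tr}[\ell(E)]$ is a finite positive measure on $\mathscr{X}$, and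 for every bounded measurable $f\colon\mathscr{X}\to\mathbb{R}$: the integral $\int f\,d\ell$ is well defined (the limit exists and does not depend on the sequence) and is a self-adjoint trace-class operator; it is positive if $f\ge 0$; and $$\operatorname{Tr}\Big[\int_{\mathscr{X}} f(x)\,\ell(dx)\Big]=\int_{\mathscr{X}} f(x)\,\operatorname{Tr}[\ell(dx)].$$ -/

import Mathlib

open Filter Topology MeasureTheory

/-- A bounded operator `T` on a Hilbert space is trace class if, with `|T| = (T* T)^(1/2)`, the
series `∑ i, ⟨b i, |T| (b i)⟩` (whose terms are nonnegative) converges for every Hilbert basis `b`.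
Hilbert bases are indexed by subsets of `H`; every Hilbert basis can be indexed by its range. -/
def IsTraceClass {H : Type*} [NormedAddCommGroup H] [InnerProductSpace ℂ H] [CompleteSpace H]
    (T : H →L[ℂ] H) : Prop :=
  ∀ (w : Set H) (b : HilbertBasis w ℂ H),
    Summable fun i : w => (inner ℂ (b i) (CFC.abs T (b i))).re

/-- `HasTrace T t` says that `Tr T = t`: the series `∑ i, ⟨b i, T (b i)⟩` converges to `t` for every
Hilbert basis `b`. -/
def HasTrace {H : Type*} [NormedAddCommGroup H] [InnerProductSpace ℂ H]
    (T : H →L[ℂ] H) (t : ℂ) : Prop :=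
  ∀ (w : Set H) (b : HilbertBasis w ℂ H), HasSum (fun i : w => inner ℂ (b i) (T (b i))) t

/-- An operator-valued measure: a map from the measurable sets to the bounded self-adjoint operators
that is countably additive in the strong operator topology. Values at non-measurable sets are
irrelevant. -/
structure OperatorValuedMeasure (X H : Type*) [MeasurableSpace X] [NormedAddCommGroup H]
    [InnerProductSpace ℂ H] [CompleteSpace H] where
  /-- The operator assigned to a set. -/
  toFun : Set X → H →L[ℂ] H
  isSelfAdjoint : ∀ E : Set X, MeasurableSet E → IsSelfAdjoint (toFun E)
  tendsto_iUnion : ∀ E : ℕ → Set X, (∀ n, MeasurableSet (E n)) →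
    Pairwise (fun i j => Disjoint (E i) (E j)) →
    ∀ ψ : H, Tendsto (fun N : ℕ => ∑ n ∈ Finset.range N, toFun (E n) ψ) atTop
      (𝓝 (toFun (⋃ n, E n) ψ))

namespace OperatorValuedMeasure

variable {X H : Type*} [MeasurableSpace X] [NormedAddCommGroup H] [InnerProductSpace ℂ H]
  [CompleteSpace H]

instance : CoeFun (OperatorValuedMeasure X H) (fun _ => Set X → H →L[ℂ] H) := ⟨toFun⟩

/-- The integral of a real-valued simple measurable function `g`: the sum of `a ℓ({g = a})` over the
finitely many values `a` of `g`. -/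
noncomputable def simpleIntegral (ℓ : OperatorValuedMeasure X H) (g : SimpleFunc X ℝ) :
    H →L[ℂ] H :=
  ∑ a ∈ g.range, (a : ℂ) • ℓ (g ⁻¹' {a})

/-- `ℓ.HasIntegral f A` says that `f` is a uniform limit of simple measurable functions, and that
for every sequence of simple measurable functions converging uniformly to `f` their integrals
converge to `A` in operator norm. -/
def HasIntegral (ℓ : OperatorValuedMeasure X H) (f : X → ℝ) (A : H →L[ℂ] H) : Prop :=
  (∃ g : ℕ → SimpleFunc X ℝ, TendstoUniformly (fun n x => g n x) f atTop) ∧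
  ∀ g : ℕ → SimpleFunc X ℝ, TendstoUniformly (fun n x => g n x) f atTop →
    Tendsto (fun n => ℓ.simpleIntegral (g n)) atTop (𝓝 A)

/-- There is at most one value of the integral. -/
theorem HasIntegral.unique {ℓ : OperatorValuedMeasure X H} {f : X → ℝ} {A B : H →L[ℂ] H}
    (hA : ℓ.HasIntegral f A) (hB : ℓ.HasIntegral f B) : A = B := by
  obtain ⟨⟨g, hg⟩, hA⟩ := hA
  exact tendsto_nhds_unique (hA g hg) (hB.2 g hg)

open Classical in
/-- The integral of `f` with respect to `ℓ`: the limit in operator norm of the integrals of simple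
measurable functions converging uniformly to `f` (and `0` if there is no such limit). -/
noncomputable def integral (ℓ : OperatorValuedMeasure X H) (f : X → ℝ) : H →L[ℂ] H :=
  if h : ∃ A, ℓ.HasIntegral f A then h.choose else 0

end OperatorValuedMeasure

open scoped ENNReal InnerProductSpace

/-! ### Hilbert–Schmidt sums and trace class criteria -/

section TraceClass

variable {H : Type*} [NormedAddCommGroup H] [InnerProductSpace ℂ H]

/-! Everything is read off from quadratic forms. For each `ψ`, `μ_ψ(E) = ⟨ψ, ℓ(E) ψ⟩` is a finite
positive measure, and `A = ∫ f dℓ` satisfies `⟨ψ, A ψ⟩ = ∫ f dμ_ψ` (`exists_hasIntegral`). Take `ν =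
∑ μ_{b i}` over a Hilbert basis. It is independent of the basis because `∑ ⟨b i, T (b i)⟩`, for `T ≥
0`, is the squared Hilbert–Schmidt norm of `√T`. The trace formula then says that integration
commutes with this sum of measures.

For `|f| ≤ C`, the form of `A` is dominated by `C` times that of `ℓ(X)`. The parts `A⁺` and `A⁻`
are, up to sign, compressions of `A`, so their traces are bounded by those of compressions of `C
ℓ(X)`, which are finite (`IsTraceClass.of_abs_inner_le`). -/

theorem HilbertBasis.tsum_enorm_inner_sq {ι : Type*} (b : HilbertBasis ι ℂ H) (x : H) :
    ∑' i, ‖inner ℂ (b i) x‖ₑ ^ 2 = ‖x‖ₑ ^ 2 := by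
  have h : HasSum (fun i => ‖inner ℂ (b i) x‖ ^ 2) (‖x‖ ^ 2) := by
    have h1 := Complex.hasSum_re (b.hasSum_inner_mul_inner x x)
    rw [inner_self_eq_norm_sq_to_K] at h1
    convert! h1 using 1
    · ext i
      rw [← inner_conj_symm x (b i), ← Complex.normSq_eq_conj_mul_self, Complex.ofReal_re,
        Complex.normSq_eq_norm_sq]
    · norm_cast
  have h2 := ENNReal.ofReal_tsum_of_nonneg (fun i => by positivity) h.summable
  rw [h.tsum_eq] at h2
  simp only [ENNReal.ofReal_pow (norm_nonneg _), ofReal_norm] at h2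
  exact h2.symm

variable [CompleteSpace H]

/-- By Parseval both sides are the double sum of `|⟨c j, R (b i)⟩|²`, and sums in `[0, ∞]` commute.
-/
theorem HilbertBasis.tsum_enorm_map_sq_eq_adjoint {ι κ : Type*} (b : HilbertBasis ι ℂ H)
    (c : HilbertBasis κ ℂ H) (R : H →L[ℂ] H) :
    ∑' i, ‖R (b i)‖ₑ ^ 2 = ∑' j, ‖ContinuousLinearMap.adjoint R (c j)‖ₑ ^ 2 := by
  simp_rw [← c.tsum_enorm_inner_sq (R _), ← b.tsum_enorm_inner_sq (ContinuousLinearMap.adjoint R _)]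
  rw [ENNReal.tsum_comm]
  refine tsum_congr fun j => tsum_congr fun i => ?_
  rw [ContinuousLinearMap.adjoint_inner_right, ← inner_conj_symm, RCLike.enorm_conj]

theorem HilbertBasis.tsum_enorm_map_sq_eq {ι κ : Type*} (b : HilbertBasis ι ℂ H)
    (c : HilbertBasis κ ℂ H) (R : H →L[ℂ] H) :
    ∑' i, ‖R (b i)‖ₑ ^ 2 = ∑' j, ‖R (c j)‖ₑ ^ 2 :=
  (b.tsum_enorm_map_sq_eq_adjoint b R).trans (c.tsum_enorm_map_sq_eq_adjoint b R).symm

/-- Passing to adjoints turns `S B` into `B* S*`, where `B*` acts last and can be bounded termwise.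
-/
theorem HilbertBasis.tsum_enorm_map_comp_sq_le {ι : Type*} (b : HilbertBasis ι ℂ H)
    (S B : H →L[ℂ] H) :
    ∑' i, ‖S (B (b i))‖ₑ ^ 2 ≤ ‖B‖ₑ ^ 2 * ∑' i, ‖S (b i)‖ₑ ^ 2 := by
  rw [b.tsum_enorm_map_sq_eq_adjoint b S, ← ENNReal.tsum_mul_left]
  refine (b.tsum_enorm_map_sq_eq_adjoint b (S ∘L B)).trans_le (ENNReal.tsum_le_tsum fun i => ?_)
  rw [ContinuousLinearMap.adjoint_comp, ← mul_pow]
  gcongr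
  refine (ContinuousLinearMap.le_opENorm (ContinuousLinearMap.adjoint B) _).trans_eq ?_
  rw [enorm_eq_iff_norm_eq.2 (ContinuousLinearMap.adjoint.norm_map B)]
  rfl

/-- The quadratic form of a positive operator is the squared norm of its square root. -/
theorem ContinuousLinearMap.IsPositive.exists_inner_eq_norm_sq {T : H →L[ℂ] H}
    (hT : T.IsPositive) : ∃ S : H →L[ℂ] H, ∀ x, (inner ℂ x (T x)).re = ‖S x‖ ^ 2 := by
  refine ⟨CFC.sqrt T, fun x => ?_⟩
  have h0 : (0 : H →L[ℂ] H) ≤ T := (ContinuousLinearMap.nonneg_iff_isPositive T).2 hT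
  have hs : (CFC.sqrt T).IsPositive :=
    (ContinuousLinearMap.nonneg_iff_isPositive _).1 (CFC.sqrt_nonneg T)
  have h1 : T x = CFC.sqrt T (CFC.sqrt T x) :=
    congrArg (fun A : H →L[ℂ] H => A x) (CFC.sqrt_mul_sqrt_self T h0).symm
  rw [h1, ← hs.inner_left_eq_inner_right, inner_self_eq_norm_sq_to_K]
  norm_cast

theorem ContinuousLinearMap.IsPositive.abs_eq {T : H →L[ℂ] H} (hT : T.IsPositive) :
    CFC.abs T = T :=
  CFC.abs_of_nonneg T ((ContinuousLinearMap.nonneg_iff_isPositive T).2 hT)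

/-- The sum of the diagonal elements of a positive operator does not depend on the Hilbert basis. -/
theorem ContinuousLinearMap.IsPositive.tsum_ofReal_inner_eq {T : H →L[ℂ] H} (hT : T.IsPositive)
    {ι κ : Type*} (b : HilbertBasis ι ℂ H) (c : HilbertBasis κ ℂ H) :
    ∑' i, ENNReal.ofReal (inner ℂ (b i) (T (b i))).re =
      ∑' j, ENNReal.ofReal (inner ℂ (c j) (T (c j))).re := by
  obtain ⟨S, hS⟩ := hT.exists_inner_eq_norm_sq
  simp only [hS, ENNReal.ofReal_pow (norm_nonneg _), ofReal_norm]
  exact b.tsum_enorm_map_sq_eq c S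

theorem IsTraceClass.tsum_ofReal_inner_ne_top {T : H →L[ℂ] H} (hT : IsTraceClass T)
    (hpos : T.IsPositive) (w : Set H) (b : HilbertBasis w ℂ H) :
    ∑' i, ENNReal.ofReal (inner ℂ (b i) (T (b i))).re ≠ ∞ := by
  have h := hT w b
  rw [hpos.abs_eq] at h
  exact h.tsum_ofReal_ne_top

/-- With `S = √T`, the sum is the squared Hilbert–Schmidt norm of `S B`. -/
theorem IsTraceClass.summable_inner_map {T : H →L[ℂ] H} (hT : IsTraceClass T)
    (hpos : T.IsPositive) (B : H →L[ℂ] H) (w : Set H) (b : HilbertBasis w ℂ H) :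
    Summable fun i => (inner ℂ (B (b i)) (T (B (b i)))).re := by
  have hfin := hT.tsum_ofReal_inner_ne_top hpos w b
  obtain ⟨S, hS⟩ := hpos.exists_inner_eq_norm_sq
  simp only [hS, ENNReal.ofReal_pow (norm_nonneg _), ofReal_norm] at hfin ⊢
  have h := ne_top_of_le_ne_top (ENNReal.mul_ne_top (by simp) hfin)
    (b.tsum_enorm_map_comp_sq_le S B)
  simpa using ENNReal.summable_toReal h

/-- The positive and negative parts of a self-adjoint operator are its compressions to
complementary closed subspaces. -/
theorem IsSelfAdjoint.exists_inner_posPart_negPart {A : H →L[ℂ] H} (hA : IsSelfAdjoint A) :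
    ∃ P Q : H →L[ℂ] H, ∀ x, inner ℂ (P x) (A (P x)) = inner ℂ x (A⁺ x) ∧
      inner ℂ (Q x) (A (Q x)) = -inner ℂ x (A⁻ x) := by
  have hp : (A⁺).IsPositive :=
    (ContinuousLinearMap.nonneg_iff_isPositive _).1 (CFC.posPart_nonneg A)
  have hn : (A⁻).IsPositive :=
    (ContinuousLinearMap.nonneg_iff_isPositive _).1 (CFC.negPart_nonneg A)
  have hsub : ∀ x, A x = A⁺ x - A⁻ x := fun x =>
    congrArg (fun T : H →L[ℂ] H => T x) (CFC.posPart_sub_negPart A hA).symm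
  have hmul : ∀ x, A⁺ (A⁻ x) = 0 := fun x =>
    congrArg (fun T : H →L[ℂ] H => T x) (CFC.posPart_mul_negPart A)
  -- Since `A⁺ A⁻ = 0`, the range of `A⁻` lies in `K`: projecting onto `K` kills `A⁺` and leaves
  -- `A⁻` unchanged.
  let K : Submodule ℂ H := (A⁺).ker
  have : CompleteSpace K := (ContinuousLinearMap.isClosed_ker A⁺).completeSpace_coe
  have hpQ : ∀ x, A⁺ (K.starProjection x) = 0 := fun x => K.starProjection_apply_mem x
  have hnQ : ∀ x, A⁻ (K.starProjection x) = A⁻ x := fun x => by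
    refine ext_inner_right ℂ fun y => ?_
    rw [hn.inner_left_eq_inner_right, hn.inner_left_eq_inner_right,
      K.inner_starProjection_left_eq_right, K.starProjection_eq_self_iff.2 (hmul y)]
  refine ⟨1 - K.starProjection, K.starProjection, fun x => ⟨?_, ?_⟩⟩
  · simp only [hsub, sub_apply, one_apply_eq_self, map_sub, hpQ,
      hnQ, sub_self, sub_zero]
    rw [inner_sub_left, ← hp.inner_left_eq_inner_right (K.starProjection x), hpQ, inner_zero_left,
      sub_zero]
  · rw [hsub, hpQ, hnQ, zero_sub, inner_neg_right, ← hn.inner_left_eq_inner_right, hnQ,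
      hn.inner_left_eq_inner_right]

/-- A self-adjoint operator whose quadratic form is dominated by that of a positive trace class
operator is trace class. -/
theorem IsTraceClass.of_abs_inner_le {A T : H →L[ℂ] H} (hT : IsTraceClass T)
    (hpos : T.IsPositive) (hA : IsSelfAdjoint A) (C : ℝ)
    (h : ∀ x, |(inner ℂ x (A x)).re| ≤ C * (inner ℂ x (T x)).re) : IsTraceClass A := by
  intro w b
  obtain ⟨P, Q, hPQ⟩ := hA.exists_inner_posPart_negPart
  refine Summable.of_nonneg_of_le (fun i => ?_) (fun i => ?_)
    (((hT.summable_inner_map hpos P w b).mul_left C).add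
      ((hT.summable_inner_map hpos Q w b).mul_left C))
  · exact ((ContinuousLinearMap.nonneg_iff_isPositive _).1
      (CFC.abs_nonneg A)).re_inner_nonneg_right (b i)
  · rw [← CFC.posPart_add_negPart A hA, add_apply, inner_add_right,
      Complex.add_re]
    refine add_le_add ?_ ?_
    · rw [← (hPQ (b i)).1]
      exact (le_abs_self _).trans (h _)
    · rw [← neg_neg (inner ℂ (b i) (A⁻ (b i))), ← (hPQ (b i)).2, Complex.neg_re]
      exact (neg_le_abs _).trans (h _)

theorem IsSelfAdjoint.opNorm_le_of_abs_inner_le {A : H →L[ℂ] H} (hA : IsSelfAdjoint A) {C : ℝ}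
    (hC : 0 ≤ C) (h : ∀ x, |(inner ℂ x (A x)).re| ≤ C * ‖x‖ ^ 2) : ‖A‖ ≤ C := by
  rw [ContinuousLinearMap.norm_eq_iSup_rayleighQuotient A hA.isSymmetric]
  refine ciSup_le fun x => ?_
  rw [ContinuousLinearMap.rayleighQuotient, ContinuousLinearMap.reApplyInnerSelf_apply,
    inner_re_symm, abs_div, abs_of_nonneg (sq_nonneg ‖x‖)]
  exact div_le_of_le_mul₀ (sq_nonneg _) hC (h x)

end TraceClass

/-! ### Uniform approximation by simple functions -/

theorem MeasureTheory.SimpleFunc.exists_tendstoUniformly {X : Type*} [MeasurableSpace X]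
    {f : X → ℝ} (hf : Measurable f) {C : ℝ} (hC : ∀ x, |f x| ≤ C) :
    ∃ g : ℕ → SimpleFunc X ℝ, TendstoUniformly (fun n x => g n x) f atTop := by
  -- Round `f` down to a multiple of `1 / (n + 1)`; boundedness makes the range finite.
  refine ⟨fun n => ⟨fun x => (⌊((n : ℝ) + 1) * f x⌋ : ℝ) / ((n : ℝ) + 1), fun y => ?_, ?_⟩, ?_⟩
  · exact measurableSet_eq_fun (by fun_prop) measurable_const
  · refine ((Set.finite_Icc ⌊((n : ℝ) + 1) * -C⌋ ⌊((n : ℝ) + 1) * C⌋).image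
      fun k : ℤ => (k : ℝ) / ((n : ℝ) + 1)).subset ?_
    rintro _ ⟨x, rfl⟩
    have hx := abs_le.1 (hC x)
    exact ⟨_, ⟨Int.floor_mono (by gcongr; exact hx.1), Int.floor_mono (by gcongr; exact hx.2)⟩, rfl⟩
  · rw [Metric.tendstoUniformly_iff]
    intro ε hε
    filter_upwards [tendsto_one_div_add_atTop_nhds_zero_nat.eventually_lt_const hε] with n hn x
    have hn0 : (0 : ℝ) < (n : ℝ) + 1 := by positivity
    refine lt_of_le_of_lt ?_ hn
    change |f x - (⌊((n : ℝ) + 1) * f x⌋ : ℝ) / ((n : ℝ) + 1)| ≤ _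
    have h : f x - (⌊((n : ℝ) + 1) * f x⌋ : ℝ) / ((n : ℝ) + 1) =
        Int.fract (((n : ℝ) + 1) * f x) / ((n : ℝ) + 1) := by
      rw [Int.fract]; field_simp
    rw [h, abs_of_nonneg (div_nonneg (Int.fract_nonneg _) hn0.le)]
    gcongr
    exact (Int.fract_lt_one _).le

theorem MeasureTheory.Integrable.of_abs_le {X : Type*} [MeasurableSpace X] {μ : Measure X}
    [IsFiniteMeasure μ] {f : X → ℝ} (hf : Measurable f) {C : ℝ} (hC : ∀ x, |f x| ≤ C) :
    Integrable f μ :=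
  .of_bound hf.aestronglyMeasurable C (ae_of_all _ hC)

/-! ### Scalar measures and existence of the integral -/

namespace OperatorValuedMeasure

variable {X H : Type*} [MeasurableSpace X] [NormedAddCommGroup H] [InnerProductSpace ℂ H]
  [CompleteSpace H]

theorem map_empty (ℓ : OperatorValuedMeasure X H) : ℓ ∅ = 0 := by
  ext ψ
  have h := ℓ.tendsto_iUnion (fun _ => ∅) (fun _ => .empty) (fun _ _ _ => disjoint_bot_left) ψ
  simp only [Set.iUnion_empty, Finset.sum_const, Finset.card_range] at h
  -- The partial sums `N • ℓ ∅ ψ` converge, so their constant increment `ℓ ∅ ψ` is `0`.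
  have h1 := (h.comp (tendsto_add_atTop_nat 1)).sub h
  simp only [Function.comp_def, add_smul, one_smul, add_sub_cancel_left, sub_self] at h1
  exact tendsto_nhds_unique tendsto_const_nhds h1

/-- For an operator-valued measure with positive values, the measure
`E ↦ ⟨ψ, ℓ(E) ψ⟩`. -/
noncomputable def quadraticMeasure (ℓ : OperatorValuedMeasure X H)
    (hℓ : ∀ E : Set X, MeasurableSet E → (ℓ E).IsPositive) (ψ : H) : Measure X :=
  Measure.ofMeasurable (fun E _ => ENNReal.ofReal (inner ℂ ψ (ℓ E ψ)).re)
    (by simp [ℓ.map_empty]) fun E hE hd => by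
      have h : Tendsto (fun N : ℕ => ∑ n ∈ Finset.range N, (inner ℂ ψ (ℓ (E n) ψ)).re) atTop
          (𝓝 (inner ℂ ψ (ℓ (⋃ n, E n) ψ)).re) := by
        have h1 := (Complex.continuous_re.tendsto _).comp
          (((innerSL ℂ ψ).continuous.tendsto _).comp (ℓ.tendsto_iUnion E hE hd ψ))
        simpa [Function.comp_def, inner_sum] using h1
      have hnn : ∀ n, 0 ≤ (inner ℂ ψ (ℓ (E n) ψ)).re := fun n =>
        (hℓ _ (hE n)).re_inner_nonneg_right ψ
      have hs := (hasSum_iff_tendsto_nat_of_nonneg hnn _).2 h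
      rw [← hs.tsum_eq]
      exact ENNReal.ofReal_tsum_of_nonneg hnn hs.summable

variable (ℓ : OperatorValuedMeasure X H)
  (hℓ : ∀ E : Set X, MeasurableSet E → (ℓ E).IsPositive)

theorem quadraticMeasure_apply (ψ : H) {E : Set X} (hE : MeasurableSet E) :
    ℓ.quadraticMeasure hℓ ψ E = ENNReal.ofReal (inner ℂ ψ (ℓ E ψ)).re :=
  Measure.ofMeasurable_apply E hE

instance (ψ : H) : IsFiniteMeasure (ℓ.quadraticMeasure hℓ ψ) :=
  ⟨by simp [quadraticMeasure_apply]⟩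

theorem quadraticMeasure_real_apply (ψ : H) {E : Set X} (hE : MeasurableSet E) :
    (ℓ.quadraticMeasure hℓ ψ).real E = (inner ℂ ψ (ℓ E ψ)).re := by
  rw [Measure.real, quadraticMeasure_apply ℓ hℓ ψ hE,
    ENNReal.toReal_ofReal (show 0 ≤ (inner ℂ ψ (ℓ E ψ)).re from (hℓ E hE).re_inner_nonneg_right ψ)]

theorem inner_eq_quadraticMeasure_real (ψ : H) {E : Set X} (hE : MeasurableSet E) :
    inner ℂ ψ (ℓ E ψ) = (((ℓ.quadraticMeasure hℓ ψ).real E : ℝ) : ℂ) := by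
  rw [quadraticMeasure_real_apply ℓ hℓ ψ hE]
  exact Complex.eq_re_of_ofReal_le (r := 0) (by simpa using (hℓ E hE).inner_nonneg_right ψ)

theorem isSelfAdjoint_simpleIntegral (g : SimpleFunc X ℝ) :
    IsSelfAdjoint (ℓ.simpleIntegral g) :=
  isSelfAdjoint_sum _ fun a _ =>
    IsSelfAdjoint.smul (Complex.conj_ofReal a)
      (ℓ.isSelfAdjoint _ (g.measurableSet_preimage _))

theorem inner_simpleIntegral (g : SimpleFunc X ℝ) (ψ : H) :
    inner ℂ ψ (ℓ.simpleIntegral g ψ) = ((∫ x, g x ∂ℓ.quadraticMeasure hℓ ψ : ℝ) : ℂ) := by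
  rw [SimpleFunc.integral_eq_sum g (g.integrable_of_isFiniteMeasure), simpleIntegral]
  simp only [sum_apply, smul_apply, inner_sum,
    inner_smul_right, Complex.ofReal_sum, smul_eq_mul, Complex.ofReal_mul]
  refine Finset.sum_congr rfl fun a _ => ?_
  rw [ℓ.inner_eq_quadraticMeasure_real hℓ ψ (g.measurableSet_preimage _), mul_comm]

theorem abs_integral_quadraticMeasure_le {f : X → ℝ} {C : ℝ} (hC : ∀ x, |f x| ≤ C) (ψ : H) :
    |∫ x, f x ∂ℓ.quadraticMeasure hℓ ψ| ≤ C * (inner ℂ ψ (ℓ Set.univ ψ)).re := by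
  rw [← quadraticMeasure_real_apply ℓ hℓ ψ .univ]
  exact norm_integral_le_of_norm_le_const (f := f) (ae_of_all _ hC)

include hℓ in
-- The norm of a self-adjoint operator is controlled by its form, here `∫ (g - h) dμ_ψ`; no common
-- refinement of the two partitions is needed.
theorem norm_simpleIntegral_sub_le {g h : SimpleFunc X ℝ} {C : ℝ} (hC0 : 0 ≤ C)
    (hC : ∀ x, |g x - h x| ≤ C) :
    ‖ℓ.simpleIntegral g - ℓ.simpleIntegral h‖ ≤ C * ‖ℓ Set.univ‖ := by
  refine ((ℓ.isSelfAdjoint_simpleIntegral g).sub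
    (ℓ.isSelfAdjoint_simpleIntegral h)).opNorm_le_of_abs_inner_le (by positivity) fun ψ => ?_
  rw [sub_apply, inner_sub_right, ℓ.inner_simpleIntegral hℓ,
    ℓ.inner_simpleIntegral hℓ, ← Complex.ofReal_sub, Complex.ofReal_re,
    ← integral_sub g.integrable_of_isFiniteMeasure h.integrable_of_isFiniteMeasure]
  refine (ℓ.abs_integral_quadraticMeasure_le hℓ hC ψ).trans ?_
  rw [mul_assoc]
  gcongr
  calc (inner ℂ ψ (ℓ Set.univ ψ)).re ≤ ‖ψ‖ * ‖ℓ Set.univ ψ‖ := re_inner_le_norm (𝕜 := ℂ) _ _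
    _ ≤ ‖ψ‖ * (‖ℓ Set.univ‖ * ‖ψ‖) := by gcongr; exact (ℓ Set.univ).le_opNorm ψ
    _ = ‖ℓ Set.univ‖ * ‖ψ‖ ^ 2 := by ring

theorem exists_tendsto_simpleIntegral {f : X → ℝ} {C : ℝ}
    (hC : ∀ x, |f x| ≤ C) {g : ℕ → SimpleFunc X ℝ}
    (hg : TendstoUniformly (fun n x => g n x) f atTop) :
    ∃ A : H →L[ℂ] H, Tendsto (fun n => ℓ.simpleIntegral (g n)) atTop (𝓝 A) ∧
      ∀ ψ, inner ℂ ψ (A ψ) = ((∫ x, f x ∂ℓ.quadraticMeasure hℓ ψ : ℝ) : ℂ) := by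
  rw [Metric.tendstoUniformly_iff] at hg
  have hcauchy : CauchySeq fun n => ℓ.simpleIntegral (g n) := by
    rw [Metric.cauchySeq_iff']
    intro ε hε
    have hM : 0 < ‖ℓ Set.univ‖ + 1 := by positivity
    -- Two errors of this size add up to `ε / (‖ℓ Set.univ‖ + 1)`; the `+ 1` avoids a zero
    -- denominator and makes the final bound strict.
    obtain ⟨N, hN⟩ := eventually_atTop.1 (hg (ε / 2 / (‖ℓ Set.univ‖ + 1)) (by positivity))
    refine ⟨N, fun n hn => ?_⟩
    rw [dist_eq_norm]
    refine (ℓ.norm_simpleIntegral_sub_le hℓ (C := ε / (‖ℓ Set.univ‖ + 1)) (by positivity)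
      fun x => ?_).trans_lt ?_
    · rw [← Real.dist_eq]
      refine (dist_triangle_left _ _ (f x)).trans ?_
      refine (add_le_add (hN n hn x).le (hN N le_rfl x).le).trans_eq ?_
      field_simp; ring
    · rw [div_mul_eq_mul_div, div_lt_iff₀ hM]
      exact mul_lt_mul_of_pos_left (lt_add_one _) hε
  obtain ⟨A, hA⟩ := cauchySeq_tendsto_of_complete hcauchy
  refine ⟨A, hA, fun ψ => ?_⟩
  have h1 : Tendsto (fun n => inner ℂ ψ (ℓ.simpleIntegral (g n) ψ)) atTop
      (𝓝 (inner ℂ ψ (A ψ))) :=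
    ((innerSL ℂ ψ).continuous.tendsto _).comp
      (((ContinuousLinearMap.apply ℂ H ψ).continuous.tendsto _).comp hA)
  simp only [ℓ.inner_simpleIntegral hℓ] at h1
  refine tendsto_nhds_unique h1 ((Complex.continuous_ofReal.tendsto _).comp ?_)
  -- Eventually `|g n - f| ≤ 1`, hence the dominating constant `C + 1`.
  refine tendsto_integral_filter_of_dominated_convergence (fun _ => C + 1)
    (.of_forall fun n => (g n).aestronglyMeasurable) ?_ (integrable_const _)
    (ae_of_all _ fun x => ?_)
  · filter_upwards [hg 1 one_pos] with n hn
    refine ae_of_all _ fun x => ?_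
    have h2 := (hn x).le
    rw [dist_comm, Real.dist_eq] at h2
    have h3 := abs_add_le (f x) (g n x - f x)
    rw [add_sub_cancel] at h3
    exact h3.trans (add_le_add (hC x) h2)
  · exact (Metric.tendstoUniformly_iff.2 hg).tendsto_at x

/-- The integral of a bounded measurable function exists, and its quadratic form is given by the
integrals with respect to the measures `⟨ψ, ℓ(·) ψ⟩`. -/
theorem exists_hasIntegral {f : X → ℝ} (hf : Measurable f) {C : ℝ} (hC : ∀ x, |f x| ≤ C) :
    ∃ A : H →L[ℂ] H, ℓ.HasIntegral f A ∧
      ∀ ψ, inner ℂ ψ (A ψ) = ((∫ x, f x ∂ℓ.quadraticMeasure hℓ ψ : ℝ) : ℂ) := by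
  obtain ⟨g, hg⟩ := SimpleFunc.exists_tendstoUniformly hf hC
  obtain ⟨A, -, hA⟩ := ℓ.exists_tendsto_simpleIntegral hℓ hC hg
  refine ⟨A, ⟨⟨g, hg⟩, fun g' hg' => ?_⟩, hA⟩
  obtain ⟨A', hlim, hA'⟩ := ℓ.exists_tendsto_simpleIntegral hℓ hC hg'
  convert! hlim using 2
  -- Both limits have the same quadratic form, which determines an operator on a complex space by
  -- polarization.
  rw [← ContinuousLinearMap.coe_inj, ← ext_inner_map]
  intro ψ
  rw [← inner_conj_symm, ← inner_conj_symm (A'.toLinearMap ψ)]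
  exact congrArg _ ((hA ψ).trans (hA' ψ).symm)

theorem hasIntegral_integral {f : X → ℝ} {A : H →L[ℂ] H} (hA : ℓ.HasIntegral f A) :
    ℓ.HasIntegral f (ℓ.integral f) := by
  have h : ∃ A, ℓ.HasIntegral f A := ⟨A, hA⟩
  rw [integral, dif_pos h]
  exact h.choose_spec

/-- The sum of the measures `⟨b i, ℓ(·) (b i)⟩` over a Hilbert basis does not depend on the
basis. -/
theorem sum_quadraticMeasure_eq {ι κ : Type*} (b : HilbertBasis ι ℂ H) (c : HilbertBasis κ ℂ H) :
    Measure.sum (fun i => ℓ.quadraticMeasure hℓ (b i)) =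
      Measure.sum fun j => ℓ.quadraticMeasure hℓ (c j) := by
  ext E hE
  simp only [Measure.sum_apply _ hE, quadraticMeasure_apply ℓ hℓ _ hE]
  exact (hℓ E hE).tsum_ofReal_inner_eq b c

end OperatorValuedMeasure

/-! ### The trace formula -/

theorem theorem4 {X H : Type*} [MeasurableSpace X]
    [NormedAddCommGroup H] [InnerProductSpace ℂ H] [CompleteSpace H]
    [TopologicalSpace.SeparableSpace H]
    (ℓ : OperatorValuedMeasure X H)
    (hℓ : ∀ E : Set X, MeasurableSet E → (ℓ E).IsPositive ∧ IsTraceClass (ℓ E)) :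
    ∃ ν : Measure X, IsFiniteMeasure ν ∧
      (∀ E : Set X, MeasurableSet E → HasTrace (ℓ E) ((ν.real E : ℝ) : ℂ)) ∧
      ∀ f : X → ℝ, Measurable f → (∃ C : ℝ, ∀ x, |f x| ≤ C) →
        ℓ.HasIntegral f (ℓ.integral f) ∧
        IsSelfAdjoint (ℓ.integral f) ∧
        IsTraceClass (ℓ.integral f) ∧
        ((∀ x, 0 ≤ f x) → (ℓ.integral f).IsPositive) ∧
        Integrable f ν ∧
        HasTrace (ℓ.integral f) ((∫ x, f x ∂ν : ℝ) : ℂ) := by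
  have hpos : ∀ E : Set X, MeasurableSet E → (ℓ E).IsPositive := fun E hE => (hℓ E hE).1
  obtain ⟨w₀, b₀, -⟩ := exists_hilbertBasis ℂ H
  let ν : Measure X := Measure.sum fun i => ℓ.quadraticMeasure hpos (b₀ i)
  have hν : IsFiniteMeasure ν := ⟨by
    rw [Measure.sum_apply _ .univ, lt_top_iff_ne_top]
    simp only [ℓ.quadraticMeasure_apply hpos _ .univ]
    exact (hℓ _ .univ).2.tsum_ofReal_inner_ne_top (hpos _ .univ) w₀ b₀⟩
  have hsum : ∀ (w : Set H) (b : HilbertBasis w ℂ H) (f : X → ℝ), Integrable f ν →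
      HasSum (fun i => ((∫ x, f x ∂ℓ.quadraticMeasure hpos (b i) : ℝ) : ℂ))
        ((∫ x, f x ∂ν : ℝ) : ℂ) := by
    intro w b f hf
    have h := ℓ.sum_quadraticMeasure_eq hpos b₀ b
    simp only [ν, h] at hf ⊢
    exact Complex.hasSum_ofReal.2 (hasSum_integral_measure hf)
  refine ⟨ν, hν, fun E hE w b => ?_, fun f hf ⟨C, hC⟩ => ?_⟩
  -- The trace of `ℓ E` is the case where `f` is the indicator of `E`.
  · have h := hsum w b (E.indicator 1) ((integrable_const 1).indicator hE)
    simp only [integral_indicator_one hE] at h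
    simpa only [ℓ.inner_eq_quadraticMeasure_real hpos _ hE] using h
  obtain ⟨A, hA, hform⟩ := ℓ.exists_hasIntegral hpos hf hC
  have hint := ℓ.hasIntegral_integral hA
  obtain rfl := hA.unique hint
  have hself : IsSelfAdjoint (ℓ.integral f) := by
    rw [ContinuousLinearMap.isSelfAdjoint_iff_isSymmetric,
      LinearMap.isSymmetric_iff_inner_map_self_real]
    intro ψ
    change starRingEnd ℂ (inner ℂ (ℓ.integral f ψ) ψ) = inner ℂ (ℓ.integral f ψ) ψ
    rw [inner_conj_symm, ← inner_conj_symm (ℓ.integral f ψ), hform, Complex.conj_ofReal]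
  have hfν : Integrable f ν := .of_abs_le hf hC
  refine ⟨hint, hself, ?_, fun h0 => ?_, hfν, fun w b => ?_⟩
  · refine (hℓ _ .univ).2.of_abs_inner_le (hpos _ .univ) hself C fun ψ => ?_
    rw [hform, Complex.ofReal_re]
    exact ℓ.abs_integral_quadraticMeasure_le hpos hC ψ
  · refine (ContinuousLinearMap.isPositive_iff' _).2 ⟨hself, fun ψ => ?_⟩
    rw [← inner_conj_symm, hform, Complex.conj_ofReal]
    exact Complex.zero_le_real.2 (integral_nonneg h0)
  · simpa only [hform] using hsum w b f hfν
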